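/- An edge-coloring of a complete graph is an arbitrary assignment of colors to its edges (not necessarily proper), and a subgraph is rainbow if all of its edges have different colors. For a graph $G$, the anti-Ramsey number $ar(K_n, G)$ is the maximum number of colors appearing in an edge-coloring of the complete graph $K_n$ that has no rainbow copy of $G$. Let $2P_4$ denote the disjoint union of two paths on four vertices each. Then $ar(K_8, 2P_4) = 16$. That is, there is an edge-coloring of $K_8$ with exactly $16$ colors and no rainbow copy of $2P_4$, and no edge-coloring of $K_8$ without a rainbow copy of $2P_4$ uses more than $16$ colors. -/

import Mathlib

open scoped SimpleGraph

/-- The copy `f` of `G` in the complete graph on `V` is rainbow under the edge-coloring `c`: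
distinct edges of the copy have distinct colors. -/
def IsRainbowCopy {V W K : Type*} {G : SimpleGraph W} (c : SimpleGraph.TopEdgeLabeling V K)
    (f : G.Copy (⊤ : SimpleGraph V)) : Prop :=
  Function.Injective fun e : G.edgeSet => c (f.mapEdgeSet e)

/-- The number of colors that actually occur in an edge-coloring of a complete graph. -/
noncomputable def numColors {V K : Type*} (c : SimpleGraph.TopEdgeLabeling V K) : ℕ :=
  (Set.range c).ncard

/-- `m` is the anti-Ramsey number `ar(K_n, G)`: the maximum number of colors in an edge-coloring
of the complete graph on `n` vertices that has no rainbow copy of `G`. -/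
def IsAntiRamseyNumber {W : Type*} (n : ℕ) (G : SimpleGraph W) (m : ℕ) : Prop :=
  IsGreatest {k : ℕ | ∃ c : SimpleGraph.TopEdgeLabeling (Fin n) ℕ,
    numColors c = k ∧ ∀ f : G.Copy (⊤ : SimpleGraph (Fin n)), ¬ IsRainbowCopy c f} m

/-- `2P₄`: two vertex-disjoint copies of the path on four vertices. -/
def twoPathFour : SimpleGraph (Fin 4 ⊕ Fin 4) :=
  SimpleGraph.pathGraph 4 ⊕g SimpleGraph.pathGraph 4

/-! Lower bound: give the 15 edges of a $K_6$ distinct colors and all other edges one further color.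
A copy of $2P_4$ spans all eight vertices, and one can pick distinct edges of it at the two outer
vertices; both have the further color.

Upper bound: a coloring with at least 17 colors yields a set $R$ of 17 edges with distinct colors,
and one exchange of edges rids it of isolated vertices (`exists_injOn_forall_mem`). That $R$
contains no $2P_4$ is not yet absurd: the join of $K_3$ with five isolated vertices has 18 edges,
and no $2P_4$ since three vertices cover its edges. But the colors give more: every edge outside $R$
can replace some edge of $R$ with all colors still distinct (`exists_injOn_insert_erase`), so these
exchanged graphs contain no $2P_4$ either.

`not_twoPathFree` excludes such an $R$ by a computation on the set of the 11 missing edges. Having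
no $2P_4$ means that, for each split of the vertices into two quadruples, the missing edges meet all
twelve paths on one of the two. A first search shows that $R$ contains a $P_4$, which relabelling
turns into 0123. A second one enumerates the possible missing sets, cuts those that isolate a
vertex, and refutes the remaining ones by an exchange (`search_sound`, `exchangeCheck_sound`). -/

/-! ### Evaluation in continuation-passing style

The functions below are written with recursors and pass evaluated numerals and lists on to a
continuation, which keeps their evaluation by the kernel cheap. -/

/-- `force n k` is `k n`, where `n` is reduced to a numeral before it is passed on. -/
noncomputable def force {α : Type} (n : ℕ) (k : ℕ → α) : α :=
  Nat.rec (k Nat.zero) (fun n _ => k (Nat.succ n)) n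

theorem force_eq {α : Type} (n : ℕ) (k : ℕ → α) : force n k = k n := by
  cases n <;> rfl

noncomputable def forceList {α : Type} (l : List ℕ) : (List ℕ → α) → α :=
  List.rec (fun k => k []) (fun x _ ih k => force x fun y => ih fun s => k (y :: s)) l

theorem forceList_eq {α : Type} (l : List ℕ) (k : List ℕ → α) : forceList l k = k l := by
  induction l generalizing k with
  | nil => rfl
  | cons x l ih =>
    change force x (fun y => forceList l fun s => k (y :: s)) = _
    rw [force_eq, ih]

noncomputable def appendK {α β : Type} (s u : List β) : (List β → α) → α :=
  List.rec (fun k => k u) (fun x _ ih k => ih fun r => k (x :: r)) s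

theorem appendK_eq {α β : Type} (s u : List β) (k : List β → α) : appendK s u k = k (s ++ u) := by
  induction s generalizing k with
  | nil => rfl
  | cons x s ih => exact ih _

/-- The members of `l` that share a bit with `b`, with the bits of `b` removed, and the others. -/
noncomputable def part {α : Type} (b : ℕ) (l : List ℕ) : (List ℕ → List ℕ → α) → α :=
  List.rec (fun k => k [] [])
    (fun x _ ih k => Nat.rec (ih fun s u => k s (x :: u))
      (fun _ _ => force (Nat.xor x b) fun y => ih fun s u => k (y :: s) u) (Nat.land x b)) l

/-- A set of positions meets the number `x`, read as a set of positions. -/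
def Hits (D : Finset ℕ) (x : ℕ) : Prop := ∃ i ∈ D, x.testBit i = true

/-- If `e ∉ D`, hits happen elsewhere and survive the removal of the bit `e`. The members in `u`
lack this bit, so `e` is not needed to hit them. -/
theorem part_spec {α : Type} (e : ℕ) (l : List ℕ) (k : List ℕ → List ℕ → α) :
    ∃ s u, part (2 ^ e) l k = k s u ∧ ∀ D : Finset ℕ, (∀ x ∈ l, Hits D x) →
      (e ∉ D → ∀ x ∈ s ++ u, Hits D x) ∧ ∀ x ∈ u, Hits (D.erase e) x := by
  induction l generalizing k with
  | nil => exact ⟨[], [], rfl, by simp⟩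
  | cons x l ih =>
    change ∃ s u, (Nat.rec (part (2 ^ e) l fun s u => k s (x :: u))
      (fun _ _ => force (Nat.xor x (2 ^ e)) fun y => part (2 ^ e) l fun s u => k (y :: s) u)
        (Nat.land x (2 ^ e)) : α) = _ ∧ _
    rcases h : Nat.land x (2 ^ e) with _ | n
    · obtain ⟨s, u, h₁, h₂⟩ := ih fun s u => k s (x :: u)
      refine ⟨s, x :: u, h₁, fun D hD => ?_⟩
      have hx : x.testBit e = false := by
        have := congrArg (Nat.testBit · e) (show x &&& 2 ^ e = 0 from h)
        simpa using this
      obtain ⟨h₃, h₄⟩ := h₂ D fun y hy => hD y (by simp [hy])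
      obtain ⟨i, hi, hxi⟩ := hD x (by simp)
      constructor
      · intro he y hy
        simp only [List.mem_append, List.mem_cons] at hy
        rcases hy with hy | rfl | hy
        · exact h₃ he y (by simp [hy])
        · exact ⟨i, hi, hxi⟩
        · exact h₃ he y (by simp [hy])
      · intro y hy
        rcases List.mem_cons.1 hy with rfl | hy
        · exact ⟨i, Finset.mem_erase.2 ⟨by rintro rfl; simp [hx] at hxi, hi⟩, hxi⟩
        · exact h₄ y hy
    · obtain ⟨s, u, h₁, h₂⟩ := ih fun s u => k (Nat.xor x (2 ^ e) :: s) u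
      refine ⟨_ :: s, u, (force_eq _ _).trans h₁, fun D hD => ?_⟩
      obtain ⟨h₃, h₄⟩ := h₂ D fun y hy => hD y (by simp [hy])
      refine ⟨fun he y hy => ?_, h₄⟩
      rcases List.mem_cons.1 hy with rfl | hy
      · obtain ⟨i, hi, hxi⟩ := hD x (by simp)
        refine ⟨i, hi, ?_⟩
        change (x ^^^ 2 ^ e).testBit i = true
        have : e ≠ i := by rintro rfl; exact he hi
        simp [hxi, this]
      · exact h₃ he y hy

/-! ### The search -/

/-- A set of positions blocks a pair of lists if it meets all members of one of the lists. -/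
def Blocked (D : Finset ℕ) (p : List ℕ × List ℕ) : Prop :=
  (∀ x ∈ p.1, Hits D x) ∨ ∀ x ∈ p.2, Hits D x

noncomputable def consIfNonempty (p q : List ℕ) (L : List (List ℕ × List ℕ)) :
    List (List ℕ × List ℕ) :=
  List.rec L (fun _ _ _ => List.rec L (fun _ _ _ => (p, q) :: L) q) p

theorem mem_consIfNonempty {p q : List ℕ} {L : List (List ℕ × List ℕ)} {r : List ℕ × List ℕ}
    (h : r ∈ consIfNonempty p q L) : r = (p, q) ∨ r ∈ L := by
  rcases p with _ | ⟨x, p⟩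
  · exact .inr h
  · rcases q with _ | ⟨y, q⟩
    · exact .inr h
    · exact List.mem_cons.1 h

/-- Splits the search at the bit `b`. The first two lists keep all pairs, with `b` removed from
their members; the pairs that this changes come first. The third list keeps only the members that
avoid `b`. -/
noncomputable def partAll {α : Type} (b : ℕ) (L : List (List ℕ × List ℕ)) :
    (List (List ℕ × List ℕ) → List (List ℕ × List ℕ) → List (List ℕ × List ℕ) → α) → α :=
  List.rec (fun k => k [] [] [])
    (fun p _ ih k => part b p.1 fun s u => part b p.2 fun s' u' =>
      List.rec
        (List.rec (ih fun c r o => k c ((u, u') :: r) ((u, u') :: o))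
          (fun _ _ _ => appendK s' u' fun t' =>
            ih fun c r o => k ((u, t') :: c) r (consIfNonempty u u' o)) s')
        (fun _ _ _ => appendK s u fun t => appendK s' u' fun t' =>
          ih fun c r o => k ((t, t') :: c) r (consIfNonempty u u' o)) s) L

/-- Pairs left out of `o` have an empty list and are blocked vacuously. -/
theorem partAll_spec {α : Type} (e : ℕ) (L : List (List ℕ × List ℕ))
    (k : List (List ℕ × List ℕ) → List (List ℕ × List ℕ) → List (List ℕ × List ℕ) → α) :
    ∃ c r o, partAll (2 ^ e) L k = k c r o ∧ ∀ D : Finset ℕ, (∀ p ∈ L, Blocked D p) →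
      (e ∉ D → ∀ p ∈ c ++ r, Blocked D p) ∧ ∀ p ∈ o, Blocked (D.erase e) p := by
  induction L generalizing k with
  | nil => exact ⟨[], [], [], rfl, by simp⟩
  | cons p L ih =>
    obtain ⟨s, u, h₁, h₂⟩ := part_spec e p.1 fun s u => part (2 ^ e) p.2 fun s' u' =>
      (List.rec
        (List.rec (partAll (2 ^ e) L fun c r o => k c ((u, u') :: r) ((u, u') :: o))
          (fun _ _ _ => appendK s' u' fun t' =>
            partAll (2 ^ e) L fun c r o => k ((u, t') :: c) r (consIfNonempty u u' o)) s')
        (fun _ _ _ => appendK s u fun t => appendK s' u' fun t' =>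
          partAll (2 ^ e) L fun c r o => k ((t, t') :: c) r (consIfNonempty u u' o)) s : α)
    obtain ⟨s', u', h₁', h₂'⟩ := part_spec e p.2 fun s' u' =>
      (List.rec
        (List.rec (partAll (2 ^ e) L fun c r o => k c ((u, u') :: r) ((u, u') :: o))
          (fun _ _ _ => appendK s' u' fun t' =>
            partAll (2 ^ e) L fun c r o => k ((u, t') :: c) r (consIfNonempty u u' o)) s')
        (fun _ _ _ => appendK s u fun t => appendK s' u' fun t' =>
          partAll (2 ^ e) L fun c r o => k ((t, t') :: c) r (consIfNonempty u u' o)) s : α)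
    have hin : ∀ D : Finset ℕ, Blocked D p → e ∉ D → Blocked D (s ++ u, s' ++ u') :=
      fun D hD he => hD.imp (fun h => (h₂ D h).1 he) (fun h => (h₂' D h).1 he)
    have hout : ∀ D : Finset ℕ, Blocked D p → Blocked (D.erase e) (u, u') :=
      fun D hD => hD.imp (fun h => (h₂ D h).2) (fun h => (h₂' D h).2)
    have key : ∀ (c r o : List (List ℕ × List ℕ)) (t t' : List ℕ)
        (c' r' o' : List (List ℕ × List ℕ)), t = s ++ u → t' = s' ++ u' →
        (∀ q ∈ c' ++ r', q = (t, t') ∨ q ∈ c ++ r) → (∀ q ∈ o', q = (u, u') ∨ q ∈ o) →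
        (∀ D : Finset ℕ, (∀ p ∈ L, Blocked D p) →
          (e ∉ D → ∀ p ∈ c ++ r, Blocked D p) ∧ ∀ p ∈ o, Blocked (D.erase e) p) →
        ∀ D : Finset ℕ, (∀ q ∈ p :: L, Blocked D q) →
          (e ∉ D → ∀ p ∈ c' ++ r', Blocked D p) ∧ ∀ p ∈ o', Blocked (D.erase e) p := by
      rintro c r o t t' c' r' o' rfl rfl hc ho h D hD
      obtain ⟨h₃, h₄⟩ := h D fun q hq => hD q (by simp [hq])
      have hp := hD p (by simp)
      constructor
      · intro he q hq
        rcases hc q hq with rfl | hq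
        · exact hin D hp he
        · exact h₃ he q hq
      · intro q hq
        rcases ho q hq with rfl | hq
        · exact hout D hp
        · exact h₄ q hq
    replace h₁ := h₁.trans h₁'
    rcases s with _ | ⟨x, s⟩
    · rcases s' with _ | ⟨x', s'⟩
      · obtain ⟨c, r, o, h₃, h₄⟩ := ih fun c r o => k c ((u, u') :: r) ((u, u') :: o)
        refine ⟨_, _, _, h₁.trans h₃, key c r o u u' _ _ _ rfl rfl ?_ ?_ h₄⟩
        · intro q hq
          simp only [List.mem_append, List.mem_cons] at hq ⊢
          tauto
        · intro q hq
          exact List.mem_cons.1 hq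
      · obtain ⟨c, r, o, h₃, h₄⟩ := ih fun c r o =>
          k ((u, x' :: s' ++ u') :: c) r (consIfNonempty u u' o)
        refine ⟨_, _, _, h₁.trans ((appendK_eq _ _ _).trans h₃),
          key c r o u _ _ _ _ rfl rfl ?_ (fun q => mem_consIfNonempty) h₄⟩
        intro q hq
        exact List.mem_cons.1 hq
    · obtain ⟨c, r, o, h₃, h₄⟩ := ih fun c r o =>
        k ((x :: s ++ u, s' ++ u') :: c) r (consIfNonempty u u' o)
      refine ⟨_, _, _, h₁.trans ((appendK_eq _ _ _).trans ((appendK_eq _ _ _).trans h₃)),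
        key c r o _ _ _ _ _ rfl rfl ?_ (fun q => mem_consIfNonempty) h₄⟩
      intro q hq
      exact List.mem_cons.1 hq

/-- Some member of `stars` is a subset of `o`. -/
noncomputable def containsStar (stars : List ℕ) (o : ℕ) : Bool :=
  List.rec false (fun s _ ih => Bool.rec ih true (Nat.beq (Nat.land o s) s)) stars

theorem containsStar_sound {stars : List ℕ} {o : ℕ} (h : containsStar stars o = true) :
    ∃ s ∈ stars, ∀ i, s.testBit i = true → o.testBit i = true := by
  induction stars with
  | nil => cases h
  | cons s l ih =>
    change (Bool.rec (containsStar l o) true (Nat.beq (Nat.land o s) s) : Bool) = true at h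
    rcases hs : Nat.beq (Nat.land o s) s
    · rw [hs] at h
      obtain ⟨t, ht, h'⟩ := ih h
      exact ⟨t, by simp [ht], h'⟩
    · refine ⟨s, by simp, fun i hi => ?_⟩
      have : o &&& s = s := Nat.eq_of_beq_eq_true hs
      rw [← this, Nat.testBit_and, Bool.and_eq_true] at hi
      exact hi.1

/-- Searches for a set of at most `k` positions that blocks all members of `L`. The number `o`
records the positions chosen so far; branches in which it contains one of the `stars` are cut, and
`leaf` is asked to refute the choice when nothing is left to be blocked. The result `true` means
that the search fails. -/
noncomputable def search (stars : List ℕ) (leaf : ℕ → ℕ → Bool) (fuel : ℕ) :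
    ℕ → ℕ → List (List ℕ × List ℕ) → Bool :=
  Nat.rec (fun _ _ _ => false) (fun _ ih k o L => Bool.rec
    (List.rec (leaf k o) (fun p _ _ => List.rec false (fun x _ _ => List.rec false (fun y _ _ =>
      force (Nat.lor x y) fun m => Nat.rec true (fun _ _ => Nat.rec true (fun k' _ =>
        force (Nat.pow 2 (Nat.log2 m)) fun b => partAll b L fun c r u =>
          -- Both branches must fail. The changed pairs stay in front, so the search continues with
          -- the split it is working on.
          Bool.rec false (appendK c r fun L' => ih k o L')
            (force (Nat.lor o b) fun o' => ih k' o' u)) k) m) p.2) p.1) L)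
    true (containsStar stars o)) fuel

/-- Here `D₀` is a hypothetical blocking set, `o` its part chosen so far, and `D` covers the rest of
it. The induction follows the branch that agrees with whether `e ∈ D`. -/
theorem search_sound {stars : List ℕ} {leaf : ℕ → ℕ → Bool} {D₀ : Finset ℕ}
    (hstar : ∀ s ∈ stars, ∃ i, s.testBit i = true ∧ i ∉ D₀)
    (hleaf : ∀ (k o : ℕ) (D : Finset ℕ), leaf k o = true → D.card ≤ k →
      (∀ i ∈ D₀, o.testBit i = true ∨ i ∈ D) → (∀ i, o.testBit i = true → i ∈ D₀) → False)
    (fuel k o : ℕ) (L : List (List ℕ × List ℕ)) (D : Finset ℕ)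
    (h : search stars leaf fuel k o L = true) (hk : D.card ≤ k)
    (hcover : ∀ i ∈ D₀, o.testBit i = true ∨ i ∈ D) (ho : ∀ i, o.testBit i = true → i ∈ D₀)
    (hD : D ⊆ D₀) (hL : ∀ p ∈ L, Blocked D p) : False := by
  induction fuel generalizing k o L D with
  | zero => cases h
  | succ fuel ih =>
    rcases hs : containsStar stars o with _ | _
    swap
    · obtain ⟨s, hs, h'⟩ := containsStar_sound hs
      obtain ⟨i, hi, hi'⟩ := hstar s hs
      exact hi' (ho i (h' i hi))
    · rcases L with _ | ⟨⟨l, l'⟩, L⟩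
      · refine hleaf k o D ?_ hk hcover ho
        change (Bool.rec (leaf k o) true (containsStar stars o) : Bool) = true at h
        rwa [hs] at h
      · rcases l with _ | ⟨x, l⟩
        · change (Bool.rec false true (containsStar stars o) : Bool) = true at h
          rw [hs] at h
          cases h
        rcases l' with _ | ⟨y, l'⟩
        · change (Bool.rec false true (containsStar stars o) : Bool) = true at h
          rw [hs] at h
          cases h
        set L₁ := (x :: l, y :: l') :: L with hL₁
        change (Bool.rec (force (Nat.lor x y) fun m => (Nat.rec true (fun _ _ => Nat.rec true
          (fun k' _ => force (Nat.pow 2 (Nat.log2 m)) fun b => partAll b L₁ fun c r u =>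
            Bool.rec false (appendK c r fun L' => search stars leaf fuel k o L')
              (force (Nat.lor o b) fun o' => search stars leaf fuel k' o' u)) k) m : Bool))
          true (containsStar stars o) : Bool) = true at h
        rw [hs] at h
        change force (Nat.lor x y) _ = true at h
        rw [force_eq] at h
        -- The first pair cannot be blocked if no position is left to choose, or if neither of its
        -- first members has a position left.
        have hne : ¬ (D = ∅ ∨ Nat.lor x y = 0) := by
          intro hm
          have hz : ∀ z, z = x ∨ z = y → ¬ Hits D z := by
            rintro z hz ⟨i, hi, hzi⟩
            rcases hm with rfl | hm
            · simp at hi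
            · have := congrArg (Nat.testBit · i) (show x ||| y = 0 from hm)
              simp at this
              rcases hz with rfl | rfl <;> simp_all
          rcases hL (x :: l, y :: l') (by simp [hL₁]) with h' | h'
          · exact hz x (.inl rfl) (h' x (by simp))
          · exact hz y (.inr rfl) (h' y (by simp))
        rcases hm : Nat.lor x y with _ | m
        · exact hne (.inr hm)
        · rcases k with _ | k
          · exact hne (.inl (by simpa using hk))
          · rw [hm] at h
            change force (2 ^ (Nat.log2 (m + 1))) _ = true at h
            rw [force_eq] at h
            set e := Nat.log2 (m + 1)
            obtain ⟨c, r, u, h₁, h₂⟩ := partAll_spec e L₁ fun c r u =>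
              (Bool.rec false (appendK c r fun L' => search stars leaf fuel (k + 1) o L')
                (force (Nat.lor o (2 ^ e)) fun o' => search stars leaf fuel k o' u) : Bool)
            replace h := h₁.symm.trans h
            obtain ⟨h₃, h₄⟩ := h₂ D hL
            rw [force_eq, appendK_eq] at h
            by_cases he : e ∈ D
            · have h₅ : search stars leaf fuel k (Nat.lor o (2 ^ e)) u = true := by
                rcases h₆ : search stars leaf fuel k (Nat.lor o (2 ^ e)) u with _ | _
                · rw [h₆] at h
                  cases h
                · rfl
              have hbit (i : ℕ) : (Nat.lor o (2 ^ e)).testBit i = true ↔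
                  o.testBit i = true ∨ e = i := by
                change (o ||| 2 ^ e).testBit i = true ↔ _
                simp [Nat.testBit_two_pow]
              refine ih _ _ _ _ h₅ ?_ ?_ ?_ ((D.erase_subset e).trans hD) h₄
              · rw [Finset.card_erase_of_mem he]
                omega
              · intro i hi
                rw [hbit, Finset.mem_erase]
                rcases hcover i hi with h' | h'
                · exact .inl (.inl h')
                · by_cases hei : e = i
                  · exact .inl (.inr hei)
                  · exact .inr ⟨Ne.symm hei, h'⟩
              · intro i hi
                rcases (hbit i).1 hi with hi | rfl
                · exact ho i hi
                · exact hD he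
            · refine ih _ _ _ _ ?_ hk hcover ho hD (h₃ he)
              rcases h₆ : search stars leaf fuel k (Nat.lor o (2 ^ e)) u with _ | _
              · rw [h₆] at h
                cases h
              · rw [h₆] at h
                exact h

/-- No set of at most `k` positions blocks all members of `L`. -/
noncomputable def refute (k : ℕ) (L : List (List ℕ × List ℕ)) : Bool :=
  -- A leaf is a blocking set, so it counts as `false`. Each step removes a position from all
  -- members; with 28 edges, a depth of 40 is ample.
  search [] (fun _ _ => false) 40 k 0 L

theorem refute_sound {k : ℕ} {L : List (List ℕ × List ℕ)} (h : refute k L = true)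
    (D : Finset ℕ) (hk : D.card ≤ k) : ¬ ∀ p ∈ L, Blocked D p := fun hL =>
  search_sound (D₀ := D) (by simp) (by simp) 40 k 0 L D h hk (by simp) (by simp) subset_rfl hL

/-! ### Leaves of the search: exchanging one missing edge -/

/-- The members of `l` that meet `o` in the empty set or in `b`, with `b` removed. -/
noncomputable def restrict {α : Type} (o b : ℕ) (l : List ℕ) : (List ℕ → α) → α :=
  List.rec (fun k => k [])
    (fun x _ ih k => force (Nat.land x o) fun t => Nat.rec (ih fun s => k (x :: s)) (fun _ _ =>
      Bool.rec (ih k) (force (Nat.xor x b) fun y => ih fun s => k (y :: s)) (Nat.beq t b)) t) l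

/-- `D` stands for the exchanged set, which avoids `e`, and `D'` for the part of it that is still
unknown. A member meeting `o` outside `e` may already be hit and is dropped; any other member can
only be hit inside `D'`. -/
theorem restrict_spec {α : Type} (o e : ℕ) (l : List ℕ) (k : List ℕ → α) :
    ∃ s, restrict o (2 ^ e) l k = k s ∧ ∀ D D' : Finset ℕ,
      (∀ i ∈ D, i ≠ e ∧ (i ∈ D' ∨ o.testBit i = true)) → (∀ x ∈ l, Hits D x) →
        ∀ x ∈ s, Hits D' x := by
  induction l generalizing k with
  | nil => exact ⟨[], rfl, by simp⟩
  | cons x l ih =>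
    have hx : Nat.land x o = 0 ∨ Nat.land x o = 2 ^ e → ∀ D D' : Finset ℕ,
        (∀ i ∈ D, i ≠ e ∧ (i ∈ D' ∨ o.testBit i = true)) → Hits D x →
          Hits D' x ∧ Hits D' (x ^^^ 2 ^ e) := by
      rintro h D D' hDD' ⟨i, hi, hxi⟩
      obtain ⟨hie, hi'⟩ := hDD' i hi
      have hD' : i ∈ D' := by
        refine hi'.resolve_right fun hoi => ?_
        have : (x &&& o).testBit i = true := by simp [hxi, hoi]
        rcases h with h | h
        · rw [show x &&& o = 0 from h] at this
          simp at this
        · rw [show x &&& o = 2 ^ e from h] at this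
          rw [Nat.testBit_two_pow, decide_eq_true_eq] at this
          exact hie this.symm
      exact ⟨⟨i, hD', hxi⟩, i, hD', by simp [hxi, hie.symm]⟩
    change ∃ s, (force (Nat.land x o) fun t => (Nat.rec (restrict o (2 ^ e) l fun s => k (x :: s))
      (fun _ _ => Bool.rec (restrict o (2 ^ e) l k) (force (Nat.xor x (2 ^ e)) fun y =>
        restrict o (2 ^ e) l fun s => k (y :: s)) (Nat.beq t (2 ^ e))) t : α)) = _ ∧ _
    rw [force_eq]
    rcases ht : Nat.land x o with _ | t
    · obtain ⟨s, h₁, h₂⟩ := ih fun s => k (x :: s)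
      refine ⟨x :: s, h₁, fun D D' h h' y hy => ?_⟩
      rcases List.mem_cons.1 hy with rfl | hy
      · exact (hx (.inl ht) D D' h (h' _ (by simp))).1
      · exact h₂ D D' h (fun z hz => h' z (by simp [hz])) y hy
    · rcases hb : Nat.beq (t + 1) (2 ^ e) with _ | _
      · obtain ⟨s, h₁, h₂⟩ := ih k
        refine ⟨s, by simpa only [hb] using h₁, fun D D' h h' =>
          h₂ D D' h fun z hz => h' z (by simp [hz])⟩
      · obtain ⟨s, h₁, h₂⟩ := ih fun s => k (Nat.xor x (2 ^ e) :: s)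
        refine ⟨_ :: s, by simpa only [hb, force_eq] using h₁, fun D D' h h' y hy => ?_⟩
        rcases List.mem_cons.1 hy with rfl | hy
        · exact (hx (.inr (ht.trans (Nat.eq_of_beq_eq_true hb))) D D' h (h' _ (by simp))).2
        · exact h₂ D D' h (fun z hz => h' z (by simp [hz])) y hy

noncomputable def restrictAll {α : Type} (o b : ℕ) (L : List (List ℕ × List ℕ)) :
    (List (List ℕ × List ℕ) → α) → α :=
  List.rec (fun k => k []) (fun p _ ih k => restrict o b p.1 fun l => List.rec (ih k) (fun _ _ _ =>
    restrict o b p.2 fun l' => List.rec (ih k) (fun _ _ _ => ih fun s => k ((l, l') :: s)) l') l) L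

theorem restrictAll_spec {α : Type} (o e : ℕ) (L : List (List ℕ × List ℕ))
    (k : List (List ℕ × List ℕ) → α) :
    ∃ s, restrictAll o (2 ^ e) L k = k s ∧ ∀ D D' : Finset ℕ,
      (∀ i ∈ D, i ≠ e ∧ (i ∈ D' ∨ o.testBit i = true)) → (∀ p ∈ L, Blocked D p) →
        ∀ p ∈ s, Blocked D' p := by
  induction L generalizing k with
  | nil => exact ⟨[], rfl, by simp⟩
  | cons p L ih =>
    obtain ⟨l, h₁, h₂⟩ := restrict_spec o e p.1 fun l => (List.rec (restrictAll o (2 ^ e) L k)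
      (fun _ _ _ => restrict o (2 ^ e) p.2 fun l' => List.rec (restrictAll o (2 ^ e) L k)
        (fun _ _ _ => restrictAll o (2 ^ e) L fun s => k ((l, l') :: s)) l') l : α)
    have skip : ∃ s, restrictAll o (2 ^ e) L k = k s ∧ ∀ D D' : Finset ℕ,
        (∀ i ∈ D, i ≠ e ∧ (i ∈ D' ∨ o.testBit i = true)) → (∀ q ∈ p :: L, Blocked D q) →
          ∀ p ∈ s, Blocked D' p := by
      obtain ⟨s, h₃, h₄⟩ := ih k
      exact ⟨s, h₃, fun D D' h h' => h₄ D D' h fun q hq => h' q (by simp [hq])⟩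
    rcases l with _ | ⟨x, l⟩
    · obtain ⟨s, h₃, h₄⟩ := skip
      exact ⟨s, h₁.trans h₃, h₄⟩
    · obtain ⟨l', h₁', h₂'⟩ := restrict_spec o e p.2 fun l' =>
        (List.rec (restrictAll o (2 ^ e) L k)
          (fun _ _ _ => restrictAll o (2 ^ e) L fun s => k ((x :: l, l') :: s)) l' : α)
      replace h₁ := h₁.trans h₁'
      rcases l' with _ | ⟨x', l'⟩
      · obtain ⟨s, h₃, h₄⟩ := skip
        exact ⟨s, h₁.trans h₃, h₄⟩
      · obtain ⟨s, h₃, h₄⟩ := ih fun s => k ((x :: l, x' :: l') :: s)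
        refine ⟨_, h₁.trans h₃, fun D D' h h' q hq => ?_⟩
        rcases List.mem_cons.1 hq with rfl | hq
        · exact (h' p (by simp)).imp (h₂ D D' h) (h₂' D D' h)
        · exact h₄ D D' h (fun q hq => h' q (by simp [hq])) q hq

/-- Some position of `o` cannot be exchanged for another one so that at most `k` further positions
suffice to block all members of `L`. -/
noncomputable def exchangeCheck (bits : List ℕ) (L : List (List ℕ × List ℕ)) (k o : ℕ) : Bool :=
  List.rec false (fun b _ ih => Nat.rec ih (fun _ _ =>
    Bool.rec ih true (restrictAll o b L fun s => refute (Nat.succ k) s)) (Nat.land o b)) bits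

theorem exchangeCheck_sound {bits : List ℕ} {L : List (List ℕ × List ℕ)} {D₀ : Finset ℕ}
    (hbits : ∀ b ∈ bits, ∃ e, b = 2 ^ e)
    (hswap : ∀ e ∈ D₀, ∃ f ≠ e, ∀ p ∈ L, Blocked (insert f (D₀.erase e)) p)
    (k o : ℕ) (D : Finset ℕ) (h : exchangeCheck bits L k o = true) (hk : D.card ≤ k)
    (hcover : ∀ i ∈ D₀, o.testBit i = true ∨ i ∈ D) (ho : ∀ i, o.testBit i = true → i ∈ D₀) :
    False := by
  induction bits with
  | nil => cases h
  | cons b l ih =>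
    replace ih := ih fun b hb => hbits b (by simp [hb])
    obtain ⟨e, rfl⟩ := hbits b (by simp)
    change (Nat.rec (exchangeCheck l L k o) (fun _ _ => Bool.rec (exchangeCheck l L k o) true
      (restrictAll o (2 ^ e) L fun s => refute (Nat.succ k) s)) (Nat.land o (2 ^ e)) : Bool) = true
      at h
    rcases hoe : Nat.land o (2 ^ e) with _ | n
    · rw [hoe] at h
      exact ih h
    · rw [hoe] at h
      obtain ⟨s, h₁, h₂⟩ := restrictAll_spec o e L fun s => refute (Nat.succ k) s
      change (Bool.rec (exchangeCheck l L k o) true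
        (restrictAll o (2 ^ e) L fun s => refute (Nat.succ k) s) : Bool) = true at h
      rw [h₁] at h
      rcases hr : refute (Nat.succ k) s with _ | _
      · rw [hr] at h
        exact ih h
      · have he : o.testBit e = true := by
          by_contra he
          have : o &&& 2 ^ e = 0 := by
            apply Nat.eq_of_testBit_eq
            intro i
            by_cases hi : e = i
            · subst hi
              simpa using he
            · simp [hi]
          have h' : o &&& 2 ^ e = n + 1 := hoe
          omega
        obtain ⟨f, hfe, hf⟩ := hswap e (ho e he)
        -- The unknown positions are the at most `k` in `D` and the new `f`, hence the bound `k +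
        -- 1`.
        refine refute_sound hr (insert f D) ((Finset.card_insert_le _ _).trans (by omega))
          (h₂ _ _ (fun i hi => ?_) hf)
        rw [Finset.mem_insert, Finset.mem_erase] at hi
        rcases hi with rfl | hi
        · exact ⟨hfe, by simp⟩
        · refine ⟨hi.1, ?_⟩
          rcases hcover i hi.2 with h' | h' <;> simp [h']

/-! ### Sets of edges as numbers -/

/-- The position of the edge `ab` in the enumeration of the pairs of natural numbers. -/
def edgeIndex (a b : ℕ) : ℕ :=
  cond (Nat.blt a b) (Nat.add (Nat.div (Nat.mul b (Nat.pred b)) 2) a)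
    (Nat.add (Nat.div (Nat.mul a (Nat.pred a)) 2) b)

def edgeBit (a b : ℕ) : ℕ := Nat.pow 2 (edgeIndex a b)

def pathMask (a b c d : ℕ) : ℕ := Nat.lor (edgeBit a b) (Nat.lor (edgeBit b c) (edgeBit c d))

/-- The twelve paths on four vertices. -/
def pathsOn (a b c d : ℕ) : List ℕ :=
  [pathMask a b c d, pathMask a b d c, pathMask a c b d, pathMask a c d b, pathMask a d b c,
   pathMask a d c b, pathMask b a c d, pathMask b a d c, pathMask b c a d, pathMask b d a c,
   pathMask c a b d, pathMask c b a d]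

/-- The splits of the eight vertices into two quadruples. -/
def splits : List (List ℕ) :=
  ((List.range' 1 7).sublistsLen 3).map fun l =>
    (0 :: l) ++ (List.range' 1 7).filter fun x => !(l.any (Nat.beq x))

/-- The quadruples among the first seven vertices. -/
def quadruples : List (List ℕ) := (List.range 7).sublistsLen 4

def starMask (v : ℕ) : ℕ :=
  ((List.range 8).filter fun b => !(Nat.beq v b)).foldr (fun b m => Nat.lor (edgeBit v b) m) 0

def starMasks : List ℕ := (List.range 8).map starMask

def edgeBits : List ℕ :=
  [27, 26, 25, 24, 23, 22, 21, 20, 19, 18, 17, 16, 15, 14, 13, 12, 11, 10, 9, 8, 7, 6, 5, 4, 3, 2,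
    1, 0].map (Nat.pow 2)

noncomputable def forceSplits (S : List (List ℕ)) :
    (List (List ℕ × List ℕ) → Bool) → Bool :=
  List.rec (fun k => k []) (fun l _ ih k =>
    match l with
    | [a, b, c, d, e, f, g, h] =>
      forceList (pathsOn a b c d) fun l => forceList (pathsOn e f g h) fun l' =>
        ih fun s => k ((l, l') :: s)
    | _ => ih k) S

def quadruplePaths : List ℕ :=
  quadruples.flatMap fun
    | [a, b, c, d] => pathsOn a b c d
    | _ => []

noncomputable def pathSearch : Bool :=
  -- The number 0 cannot be hit, so the second alternative of the pair is void. The budget is 11 =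
  -- 28 - 17.
  forceList quadruplePaths fun l => refute 11 [(l, [0])]

/-- The search for the complement of a graph with 17 edges that contains the path `0123`, has no
isolated vertices and no `2P₄`, and keeps the latter property under the exchanges of edges that a
coloring provides. -/
noncomputable def twoPathSearch : Bool :=
  forceList starMasks fun st => forceList edgeBits fun bs => forceSplits splits fun L =>
    -- The bits 1, 4 and 32 belong to the edges 01, 12 and 23, which are not missing.
    partAll 1 L fun c r _ => appendK c r fun L₁ =>
      partAll 4 L₁ fun c r _ => appendK c r fun L₂ =>
        partAll 32 L₂ fun c r _ => appendK c r fun L₃ =>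
          -- The exchange check needs the original `L`, since an exchange may remove an edge of the
          -- path 0123.
          search st (exchangeCheck bs L) 40 11 0 L₃

set_option maxRecDepth 100000 in
theorem pathSearch_eq_true : pathSearch = true := by decide +kernel

set_option maxRecDepth 100000 in
theorem twoPathSearch_eq_true : twoPathSearch = true := by decide +kernel

theorem forceSplits_spec (S : List (List ℕ)) (k : List (List ℕ × List ℕ) → Bool) :
    ∃ s : List (List ℕ × List ℕ), forceSplits S k = k s ∧ ∀ p ∈ s, ∃ a b c d e f g h,
      [a, b, c, d, e, f, g, h] ∈ S ∧ p = (pathsOn a b c d, pathsOn e f g h) := by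
  induction S generalizing k with
  | nil => exact ⟨[], rfl, by simp⟩
  | cons l S ih =>
    change ∃ s : List (List ℕ × List ℕ), (match l with
      | [a, b, c, d, e, f, g, h] =>
        forceList (pathsOn a b c d) fun l => forceList (pathsOn e f g h) fun l' =>
          forceSplits S fun s => k ((l, l') :: s)
      | _ => forceSplits S k) = _ ∧ _
    split
    · rename_i a b c d e f g h
      rw [forceList_eq, forceList_eq]
      obtain ⟨s, h₁, h₂⟩ := ih fun s => k ((pathsOn a b c d, pathsOn e f g h) :: s)
      refine ⟨_, h₁, fun p hp => ?_⟩
      rcases List.mem_cons.1 hp with rfl | hp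
      · exact ⟨a, b, c, d, e, f, g, h, by simp, rfl⟩
      · obtain ⟨a, b, c, d, e, f, g, h, hS, rfl⟩ := h₂ p hp
        exact ⟨a, b, c, d, e, f, g, h, by simp [hS], rfl⟩
    · obtain ⟨s, h₁, h₂⟩ := ih k
      refine ⟨_, h₁, fun p hp => ?_⟩
      obtain ⟨a, b, c, d, e, f, g, h, hS, rfl⟩ := h₂ p hp
      exact ⟨a, b, c, d, e, f, g, h, by simp [hS], rfl⟩

theorem exists_of_partAll_appendK {e : ℕ} {L : List (List ℕ × List ℕ)}
    {k : List (List ℕ × List ℕ) → Bool}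
    (h : (partAll (2 ^ e) L fun c r _ => appendK c r k) = true) :
    ∃ L', k L' = true ∧ ∀ D : Finset ℕ, e ∉ D → (∀ p ∈ L, Blocked D p) →
      ∀ p ∈ L', Blocked D p := by
  obtain ⟨c, r, o, h₁, h₂⟩ := partAll_spec e L fun c r _ => appendK c r k
  rw [h₁, appendK_eq] at h
  exact ⟨c ++ r, h, fun D he hL => (h₂ D hL).1 he⟩

/-! ### Graphs on eight vertices -/

def pathEdges {V : Type*} [DecidableEq V] (a b c d : V) : Finset (Sym2 V) :=
  {s(a, b), s(b, c), s(c, d)}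

/-- The set of edges `S` contains no copy of `2P₄`. -/
def TwoPathFree {V : Type*} [DecidableEq V] (S : Finset (Sym2 V)) : Prop :=
  ∀ a b c d e f g h : V, [a, b, c, d].Nodup → [e, f, g, h].Nodup →
    [a, b, c, d].Disjoint [e, f, g, h] → pathEdges a b c d ⊆ S → ¬ pathEdges e f g h ⊆ S

def edgeCode : Sym2 (Fin 8) → ℕ :=
  Sym2.lift ⟨fun a b => edgeIndex a b, by decide +kernel⟩

theorem edgeCode_injOn : ∀ z w : Sym2 (Fin 8), ¬ z.IsDiag → ¬ w.IsDiag →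
    edgeCode z = edgeCode w → z = w := by
  have : ∀ a b c d : Fin 8, a ≠ b → c ≠ d → edgeIndex a b = edgeIndex c d →
      s(a, b) = s(c, d) := by decide +kernel
  intro z w
  induction z with
  | _ a b =>
    induction w with
    | _ c d => exact this a b c d

theorem testBit_pathMask (a b c d i : ℕ) : (pathMask a b c d).testBit i = true ↔
    i = edgeIndex a b ∨ i = edgeIndex b c ∨ i = edgeIndex c d := by
  change (2 ^ _ ||| (2 ^ _ ||| 2 ^ _)).testBit i = true ↔ _
  simp only [Nat.testBit_or, Nat.testBit_two_pow, Bool.or_eq_true, decide_eq_true_eq]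
  constructor <;> rintro (h | h | h) <;> simp [h]

theorem exists_of_mem_pathsOn {a b c d x : ℕ} (hx : x ∈ pathsOn a b c d) :
    ∃ a' b' c' d', x = pathMask a' b' c' d' ∧ (∀ v, v ∈ [a', b', c', d'] ↔ v ∈ [a, b, c, d]) ∧
      ([a, b, c, d].Nodup → [a', b', c', d'].Nodup) := by
  simp only [pathsOn, List.mem_cons, List.not_mem_nil, or_false] at hx
  rcases hx with rfl | rfl | rfl | rfl | rfl | rfl | rfl | rfl | rfl | rfl | rfl | rfl <;>
    exact ⟨_, _, _, _, rfl, by grind, by grind⟩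

theorem exists_pathEdges_subset {S : Finset (Sym2 (Fin 8))} {D : Finset ℕ}
    (hD : ∀ z, ¬ z.IsDiag → z ∉ S → edgeCode z ∈ D) {a b c d x : ℕ}
    (hlt : ∀ v ∈ [a, b, c, d], v < 8) (hnd : [a, b, c, d].Nodup) (hx : x ∈ pathsOn a b c d)
    (h : ¬ Hits D x) :
    ∃ p q r s : Fin 8, [p, q, r, s].Nodup ∧ pathEdges p q r s ⊆ S ∧
      ∀ v ∈ [p, q, r, s], (v : ℕ) ∈ [a, b, c, d] := by
  obtain ⟨p, q, r, s, rfl, hmem, hnd'⟩ := exists_of_mem_pathsOn hx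
  replace hnd' := hnd' hnd
  have hlt' : ∀ v ∈ [p, q, r, s], v < 8 := fun v hv => hlt v ((hmem v).1 hv)
  lift p to Fin 8 using hlt' p (by simp)
  lift q to Fin 8 using hlt' q (by simp)
  lift r to Fin 8 using hlt' r (by simp)
  lift s to Fin 8 using hlt' s (by simp)
  have hnd'' : [p, q, r, s].Nodup := by
    refine List.Nodup.of_map (Fin.val : Fin 8 → ℕ) ?_
    simpa using hnd'
  refine ⟨p, q, r, s, hnd'', ?_, fun v hv => (hmem v).1 ?_⟩
  · have key : ∀ u v : Fin 8, u ≠ v → (pathMask p q r s).testBit (edgeIndex u v) = true →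
        s(u, v) ∈ S := by
      intro u v huv hb
      by_contra hS
      exact h ⟨_, hD s(u, v) (by simpa using huv) hS, hb⟩
    simp only [List.nodup_cons, List.mem_cons, not_or, List.not_mem_nil] at hnd''
    intro z hz
    simp only [pathEdges, Finset.mem_insert, Finset.mem_singleton] at hz
    rcases hz with rfl | rfl | rfl
    · exact key _ _ hnd''.1.1 (by simp [testBit_pathMask])
    · exact key _ _ hnd''.2.1.1 (by simp [testBit_pathMask])
    · exact key _ _ hnd''.2.2.1.1 (by simp [testBit_pathMask])
  · simp only [List.mem_cons, List.not_mem_nil, or_false] at hv ⊢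
    rcases hv with rfl | rfl | rfl | rfl <;> simp

/-- Unhit paths on both quadruples would lie in `S` and form a $2P_4$. `D` may exceed the set of
missing edges, so the lemma also serves for exchanged sets. -/
theorem blocked_of_twoPathFree {S : Finset (Sym2 (Fin 8))} (hS : TwoPathFree S) {D : Finset ℕ}
    (hD : ∀ z, ¬ z.IsDiag → z ∉ S → edgeCode z ∈ D) {a b c d e f g h : ℕ}
    (hmem : [a, b, c, d, e, f, g, h] ∈ splits) :
    Blocked D (pathsOn a b c d, pathsOn e f g h) := by
  have hsplits : ∀ l ∈ splits, (∀ v ∈ l, v < 8) ∧ l.Nodup := by decide +kernel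
  obtain ⟨hlt, hnd⟩ := hsplits _ hmem
  have hnd' : ([a, b, c, d] ++ [e, f, g, h]).Nodup := hnd
  rw [List.nodup_append'] at hnd'
  unfold Blocked
  by_contra! hcon
  obtain ⟨⟨x, hx, hx'⟩, y, hy, hy'⟩ := hcon
  obtain ⟨p, q, r, s, h₁, h₂, h₃⟩ := exists_pathEdges_subset hD
    (fun v hv => hlt v (by simp only [List.mem_cons] at hv ⊢; tauto)) hnd'.1 hx hx'
  obtain ⟨p', q', r', s', h₁', h₂', h₃'⟩ := exists_pathEdges_subset hD
    (fun v hv => hlt v (by simp only [List.mem_cons] at hv ⊢; tauto)) hnd'.2.1 hy hy'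
  exact hS p q r s p' q' r' s' h₁ h₁' (fun v hv hv' => hnd'.2.2 (h₃ v hv) (h₃' v hv')) h₂ h₂'

def edgesEight : Finset (Sym2 (Fin 8)) := Finset.univ.filter fun z => ¬ z.IsDiag

theorem card_edgesEight : edgesEight.card = 28 := by decide +kernel

theorem mem_edgesEight {z : Sym2 (Fin 8)} : z ∈ edgesEight ↔ ¬ z.IsDiag := by simp [edgesEight]

/-- The positions of the edges that are not in `R`. -/
def missing (R : Finset (Sym2 (Fin 8))) : Finset ℕ := (edgesEight \ R).image edgeCode

theorem edgeCode_mem_missing {R : Finset (Sym2 (Fin 8))} (z : Sym2 (Fin 8)) (hz : ¬ z.IsDiag)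
    (hR : z ∉ R) : edgeCode z ∈ missing R :=
  Finset.mem_image_of_mem _ (Finset.mem_sdiff.2 ⟨mem_edgesEight.2 hz, hR⟩)

theorem edgeCode_notMem_missing {R : Finset (Sym2 (Fin 8))} (hR : R ⊆ edgesEight)
    {z : Sym2 (Fin 8)} (hz : z ∈ R) : edgeCode z ∉ missing R := by
  intro h
  obtain ⟨w, hw, h⟩ := Finset.mem_image.1 h
  rw [Finset.mem_sdiff] at hw
  obtain rfl := edgeCode_injOn w z (mem_edgesEight.1 hw.1) (mem_edgesEight.1 (hR hz)) h
  exact hw.2 hz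

theorem card_missing_le {R : Finset (Sym2 (Fin 8))} (hR : R ⊆ edgesEight) (hc : R.card = 17) :
    (missing R).card ≤ 11 := by
  refine Finset.card_image_le.trans ?_
  rw [Finset.card_sdiff_of_subset hR, card_edgesEight, hc]

/-- Seven vertices suffice: at least 10 of the 17 edges avoid the last vertex, more than a graph on
seven vertices without $P_4$ can have. -/
theorem exists_pathEdges_of_card {R : Finset (Sym2 (Fin 8))} (hR : R ⊆ edgesEight)
    (hc : R.card = 17) : ∃ a b c d : Fin 8, [a, b, c, d].Nodup ∧ pathEdges a b c d ⊆ R := by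
  have h := pathSearch_eq_true
  rw [pathSearch, forceList_eq] at h
  have hb := refute_sound h (missing R) (card_missing_le hR hc)
  simp only [List.mem_singleton, forall_eq, Blocked, not_or, not_forall] at hb
  obtain ⟨⟨x, hx, hx'⟩, -⟩ := hb
  obtain ⟨l, hl, hx⟩ := List.mem_flatMap.1 hx
  have hquad : ∀ l ∈ quadruples, (∀ v ∈ l, v < 8) ∧ l.Nodup := by decide +kernel
  split at hx
  · obtain ⟨p, q, r, s, h₁, h₂, -⟩ := exists_pathEdges_subset edgeCode_mem_missing
      (hquad _ hl).1 (hquad _ hl).2 hx hx'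
    exact ⟨p, q, r, s, h₁, h₂⟩
  · simp at hx

theorem not_twoPathFree_of_path {R : Finset (Sym2 (Fin 8))} (hR : R ⊆ edgesEight)
    (hc : R.card = 17) (hiso : ∀ v, ∃ z ∈ R, v ∈ z) (hpath : pathEdges 0 1 2 3 ⊆ R)
    (hswap : ∀ z ∈ edgesEight, z ∉ R → ∃ f ∈ R, TwoPathFree (insert z (R.erase f))) :
    ¬ TwoPathFree R := by
  intro hfree
  have h := twoPathSearch_eq_true
  rw [twoPathSearch, forceList_eq, forceList_eq] at h
  obtain ⟨L, h₁, h₂⟩ := forceSplits_spec splits fun L =>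
    partAll 1 L fun c r _ => appendK c r fun L₁ =>
      partAll 4 L₁ fun c r _ => appendK c r fun L₂ =>
        partAll 32 L₂ fun c r _ => appendK c r fun L₃ =>
          search starMasks (exchangeCheck edgeBits L) 40 11 0 L₃
  rw [h₁] at h
  obtain ⟨L₁, h, hL₁⟩ := exists_of_partAll_appendK (e := 0) h
  obtain ⟨L₂, h, hL₂⟩ := exists_of_partAll_appendK (e := 2) h
  obtain ⟨L₃, h, hL₃⟩ := exists_of_partAll_appendK (e := 5) h
  have hout : ∀ z ∈ pathEdges (0 : Fin 8) 1 2 3, edgeCode z ∉ missing R := fun z hz =>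
    edgeCode_notMem_missing hR (hpath hz)
  refine search_sound (D₀ := missing R) ?_ (exchangeCheck_sound ?_ ?_) 40 11 0 L₃ (missing R) h
    (card_missing_le hR hc) (by simp) (by simp) subset_rfl ?_
  · intro s hs
    obtain ⟨v, hv, rfl⟩ := List.mem_map.1 hs
    lift v to Fin 8 using List.mem_range.1 hv
    obtain ⟨z, hz, hvz⟩ := hiso v
    refine ⟨edgeCode z, ?_, edgeCode_notMem_missing hR hz⟩
    obtain ⟨b, rfl⟩ := Sym2.mem_iff_exists.1 hvz
    have hvb : v ≠ b := by simpa using mem_edgesEight.1 (hR hz)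
    have : ∀ v b : Fin 8, v ≠ b → (starMask v).testBit (edgeIndex v b) = true := by
      decide +kernel
    exact this v b hvb
  · intro b hb
    obtain ⟨e, -, rfl⟩ := List.mem_map.1 hb
    exact ⟨e, rfl⟩
  · intro e he
    obtain ⟨z, hz, rfl⟩ := Finset.mem_image.1 he
    rw [Finset.mem_sdiff] at hz
    obtain ⟨f, hf, hfree'⟩ := hswap z hz.1 hz.2
    refine ⟨edgeCode f, fun hfz => ?_, fun p hp => ?_⟩
    · exact edgeCode_notMem_missing hR hf (hfz ▸ he)
    · obtain ⟨a, b, c, d, e, f', g, h, hS, rfl⟩ := h₂ p hp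
      refine blocked_of_twoPathFree hfree' (fun w hw hw' => ?_) hS
      rw [Finset.mem_insert, Finset.mem_erase, not_or, not_and_or, not_ne_iff] at hw'
      rw [Finset.mem_insert, Finset.mem_erase]
      rcases hw'.2 with rfl | hwR
      · exact .inl rfl
      · exact .inr ⟨fun h => hw'.1 (edgeCode_injOn w z hw (mem_edgesEight.1 hz.1) h),
          edgeCode_mem_missing w hw hwR⟩
  · refine hL₃ _ (hout s(2, 3) (by decide)) (hL₂ _ (hout s(1, 2) (by decide))
      (hL₁ _ (hout s(0, 1) (by decide)) fun p hp => ?_))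
    obtain ⟨a, b, c, d, e, f, g, h, hS, rfl⟩ := h₂ p hp
    exact blocked_of_twoPathFree hfree edgeCode_mem_missing hS

/-! ### Relabelling the vertices -/

theorem TwoPathFree.image_map {V : Type*} [DecidableEq V] {S : Finset (Sym2 V)}
    (hS : TwoPathFree S) (σ : Equiv.Perm V) : TwoPathFree (S.image (Sym2.map σ)) := by
  have key : ∀ a b c d : V, pathEdges a b c d ⊆ S.image (Sym2.map σ) →
      pathEdges (σ.symm a) (σ.symm b) (σ.symm c) (σ.symm d) ⊆ S := by
    intro a b c d h
    have hmem : ∀ u v : V, s(u, v) ∈ pathEdges a b c d → s(σ.symm u, σ.symm v) ∈ S := by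
      intro u v huv
      obtain ⟨w, hw, hw'⟩ := Finset.mem_image.1 (h huv)
      have : w = Sym2.map σ.symm s(u, v) := by
        rw [← hw', Sym2.map_map]
        simp
      rwa [this] at hw
    intro z hz
    simp only [pathEdges, Finset.mem_insert, Finset.mem_singleton] at hz
    rcases hz with rfl | rfl | rfl <;> exact hmem _ _ (by simp [pathEdges])
  intro a b c d e f g h hnd hnd' hdisj h₁ h₂
  exact hS _ _ _ _ _ _ _ _ (hnd.map σ.symm.injective) (hnd'.map σ.symm.injective)
    (List.disjoint_map σ.symm.injective hdisj) (key _ _ _ _ h₁) (key _ _ _ _ h₂)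

theorem exists_perm_of_nodup {a b c d : Fin 8} (h : [a, b, c, d].Nodup) :
    ∃ σ : Equiv.Perm (Fin 8), σ a = 0 ∧ σ b = 1 ∧ σ c = 2 ∧ σ d = 3 := by
  obtain ⟨g, hg⟩ := Finset.exists_equiv_extend_of_card_eq (α := Fin 8) (t := Finset.univ)
    -- Only the first four values matter; the other entries are fillers.
    (s := {0, 1, 2, 3}) (f := ![a, b, c, d, a, a, a, a]) (by simp) (by simp) (by
      simp only [List.nodup_cons, List.mem_cons, not_or, List.not_mem_nil] at h
      intro i hi j hj hij
      simp only [Finset.coe_insert, Finset.coe_singleton, Set.mem_insert_iff,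
        Set.mem_singleton_iff] at hi hj
      rcases hi with rfl | rfl | rfl | rfl <;> rcases hj with rfl | rfl | rfl | rfl <;>
        simp_all [eq_comm])
  let τ : Equiv.Perm (Fin 8) := g.trans (Equiv.subtypeUnivEquiv fun x => Finset.mem_univ x)
  have hτ : ∀ i ∈ ({0, 1, 2, 3} : Finset (Fin 8)), τ i = ![a, b, c, d, a, a, a, a] i := hg
  refine ⟨τ.symm, ?_, ?_, ?_, ?_⟩ <;> rw [Equiv.symm_apply_eq, hτ _ (by simp)] <;> rfl

/-- A graph on eight vertices with 17 edges and without isolated vertices contains `2P₄`, or does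
so after the addition of some edge, whichever edge is removed in exchange. -/
theorem not_twoPathFree {R : Finset (Sym2 (Fin 8))} (hR : R ⊆ edgesEight)
    (hc : R.card = 17) (hiso : ∀ v, ∃ z ∈ R, v ∈ z)
    (hswap : ∀ z ∈ edgesEight, z ∉ R → ∃ f ∈ R, TwoPathFree (insert z (R.erase f))) :
    ¬ TwoPathFree R := by
  intro hfree
  obtain ⟨a, b, c, d, hnd, hpath⟩ := exists_pathEdges_of_card hR hc
  obtain ⟨σ, rfl, h₁, h₂, h₃⟩ : ∃ σ : Equiv.Perm (Fin 8), a = σ.symm 0 ∧ b = σ.symm 1 ∧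
      c = σ.symm 2 ∧ d = σ.symm 3 := by
    obtain ⟨σ, h₀, h₁, h₂, h₃⟩ := exists_perm_of_nodup hnd
    exact ⟨σ, by simp [← h₀], by simp [← h₁], by simp [← h₂], by simp [← h₃]⟩
  subst h₁ h₂ h₃
  have hinj : Function.Injective (Sym2.map σ) := Sym2.map.injective σ.injective
  have hback : ∀ z, Sym2.map σ (Sym2.map σ.symm z) = z := fun z => by
    rw [Sym2.map_map]
    simp
  have hdiag : ∀ (τ : Equiv.Perm (Fin 8)) z, z ∈ edgesEight → Sym2.map τ z ∈ edgesEight := by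
    intro τ z hz
    induction z with
    | _ u v => simpa [mem_edgesEight] using hz
  refine not_twoPathFree_of_path (R := R.image (Sym2.map σ)) ?_ ?_ ?_ ?_ ?_ (hfree.image_map σ)
  · intro z hz
    obtain ⟨w, hw, rfl⟩ := Finset.mem_image.1 hz
    exact hdiag σ w (hR hw)
  · rw [Finset.card_image_of_injective _ hinj, hc]
  · intro v
    obtain ⟨z, hz, hv⟩ := hiso (σ.symm v)
    exact ⟨_, Finset.mem_image_of_mem _ hz, Sym2.mem_map.2 ⟨_, hv, by simp⟩⟩
  · intro z hz
    rw [← hback z]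
    refine Finset.mem_image_of_mem _ (hpath ?_)
    simp only [pathEdges, Finset.mem_insert, Finset.mem_singleton] at hz ⊢
    rcases hz with rfl | rfl | rfl <;> simp
  · intro z hz hzR
    have hz' : Sym2.map σ.symm z ∉ R := fun h =>
      hzR (hback z ▸ Finset.mem_image_of_mem (Sym2.map σ) h)
    obtain ⟨f, hf, hf'⟩ := hswap _ (hdiag σ.symm z hz) hz'
    refine ⟨Sym2.map σ f, Finset.mem_image_of_mem _ hf, ?_⟩
    have := hf'.image_map σ
    rwa [Finset.image_insert, hback, Finset.image_erase hinj] at this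

/-! ### Exchanges that keep the colors distinct -/

/-- Exchanging an edge of a set of edges with distinct colors for a new edge. -/
theorem exists_injOn_insert_erase {α K : Type*} [DecidableEq α] {κ : α → K} {R : Finset α}
    (hinj : Set.InjOn κ R) (hne : R.Nonempty) {z : α} (hz : z ∉ R) :
    ∃ f ∈ R, Set.InjOn κ (insert z (R.erase f) : Finset α) := by
  obtain ⟨f, hf, h⟩ : ∃ f ∈ R, ∀ g ∈ R, κ g = κ z → g = f := by
    -- If the color of `z` does not occur in `R`, any `f` will do.
    by_cases h : ∃ f ∈ R, κ f = κ z
    · obtain ⟨f, hf, h⟩ := h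
      exact ⟨f, hf, fun g hg h' => hinj hg hf (h'.trans h.symm)⟩
    · obtain ⟨f, hf⟩ := hne
      exact ⟨f, hf, fun g hg h' => (h ⟨g, hg, h'⟩).elim⟩
  refine ⟨f, hf, ?_⟩
  rw [Finset.coe_insert, Set.injOn_insert (by simp [hz])]
  refine ⟨hinj.mono (by simp), ?_⟩
  rintro ⟨g, hg, h'⟩
  rw [Finset.mem_coe, Finset.mem_erase] at hg
  exact hg.1 (h g hg.2 h')

/-- If `v` is isolated, exchange some edge for an edge at `v`. A vertex `u` isolated afterwards
would leave 16 old edges avoiding both `u` and `v`, but six vertices span only 15. -/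
theorem exists_injOn_forall_mem {K : Type*} {κ : Sym2 (Fin 8) → K} {R : Finset (Sym2 (Fin 8))}
    (hR : R ⊆ edgesEight) (hc : R.card = 17) (hinj : Set.InjOn κ R) :
    ∃ R' ⊆ edgesEight, R'.card = 17 ∧ Set.InjOn κ R' ∧ ∀ v, ∃ z ∈ R', v ∈ z := by
  by_cases hiso : ∀ v, ∃ z ∈ R, v ∈ z
  · exact ⟨R, hR, hc, hinj, hiso⟩
  push Not at hiso
  obtain ⟨v, hv⟩ := hiso
  obtain ⟨x, hx⟩ := exists_ne v
  have hzR : s(v, x) ∉ R := fun h => hv _ h (by simp)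
  obtain ⟨f, hf, hinj'⟩ := exists_injOn_insert_erase hinj (Finset.card_pos.1 (by omega)) hzR
  have hce : (R.erase f).card = 16 := by rw [Finset.card_erase_of_mem hf, hc]
  refine ⟨insert s(v, x) (R.erase f), ?_, ?_, hinj', fun u => ?_⟩
  · rw [Finset.insert_subset_iff]
    exact ⟨mem_edgesEight.2 (by simpa using hx.symm), (R.erase_subset f).trans hR⟩
  · rw [Finset.card_insert_of_notMem (fun h => hzR (Finset.mem_of_mem_erase h)), hce]
  · by_contra! hu
    have huv : v ≠ u := by
      rintro rfl
      exact hu s(v, x) (by simp) (by simp)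
    have hcard : ∀ v u : Fin 8, v ≠ u →
        (edgesEight.filter fun z => v ∉ z ∧ u ∉ z).card ≤ 15 := by decide +kernel
    have hsub : R.erase f ⊆ edgesEight.filter fun z => v ∉ z ∧ u ∉ z := by
      intro z hz
      exact Finset.mem_filter.2 ⟨hR (Finset.mem_of_mem_erase hz),
        hv z (Finset.mem_of_mem_erase hz), hu z (Finset.mem_insert_of_mem hz)⟩
    have := Finset.card_le_card hsub
    have := hcard v u huv
    omega

/-! ### Edge-colorings -/

theorem mem_edgeSet_top_iff {z : Sym2 (Fin 8)} :
    z ∈ (⊤ : SimpleGraph (Fin 8)).edgeSet ↔ z ∈ edgesEight := by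
  rw [mem_edgesEight]
  induction z with
  | _ a b => simp

theorem twoPathFree_of_not_isRainbowCopy {K : Type*} {c : SimpleGraph.TopEdgeLabeling (Fin 8) K}
    (hc : ∀ f : twoPathFour.Copy (⊤ : SimpleGraph (Fin 8)), ¬ IsRainbowCopy c f)
    {κ : Sym2 (Fin 8) → K} (hκ : ∀ e, κ e.1 = c e) {S : Finset (Sym2 (Fin 8))}
    (hS : Set.InjOn κ S) : TwoPathFree S := by
  intro a₀ a₁ a₂ a₃ b₀ b₁ b₂ b₃ hnd hnd' hdisj h₁ h₂
  let p : Fin 4 ⊕ Fin 4 → Fin 8 := Sum.elim ![a₀, a₁, a₂, a₃] ![b₀, b₁, b₂, b₃]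
  have hp : Function.Injective p := by
    refine Function.Injective.sumElim ?_ ?_ ?_
    · have := List.nodup_iff_injective_get.1 hnd
      intro i j hij
      refine this (a₁ := i) (a₂ := j) ?_
      fin_cases i <;> fin_cases j <;> exact hij
    · have := List.nodup_iff_injective_get.1 hnd'
      intro i j hij
      refine this (a₁ := i) (a₂ := j) ?_
      fin_cases i <;> fin_cases j <;> exact hij
    · intro i j hij
      refine hdisj (a := ![a₀, a₁, a₂, a₃] i) ?_ ?_
      · fin_cases i <;> simp
      · rw [hij]
        fin_cases j <;> simp
  let f : twoPathFour.Copy (⊤ : SimpleGraph (Fin 8)) := ⟨⟨p, fun h => hp.ne h.ne⟩, hp⟩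
  have hmem : ∀ e : twoPathFour.edgeSet, (f.mapEdgeSet e).1 ∈ S := by
    have hA : ∀ i j : Fin 4, i.val + 1 = j.val → s(p (.inl i), p (.inl j)) ∈ S := by
      intro i j hij
      apply h₁
      fin_cases i <;> fin_cases j <;> simp [p, pathEdges] at hij ⊢
    have hB : ∀ i j : Fin 4, i.val + 1 = j.val → s(p (.inr i), p (.inr j)) ∈ S := by
      intro i j hij
      apply h₂
      fin_cases i <;> fin_cases j <;> simp [p, pathEdges] at hij ⊢
    rintro ⟨e, he⟩
    induction e with
    | _ u v =>
      change s(p u, p v) ∈ S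
      rcases u with i | i <;> rcases v with j | j
      · rcases SimpleGraph.pathGraph_adj.1 (show (SimpleGraph.pathGraph 4).Adj i j from he)
          with h | h
        · exact hA i j h
        · rw [Sym2.eq_swap]
          exact hA j i h
      · simp [twoPathFour] at he
      · simp [twoPathFour] at he
      · rcases SimpleGraph.pathGraph_adj.1 (show (SimpleGraph.pathGraph 4).Adj i j from he)
          with h | h
        · exact hB i j h
        · rw [Sym2.eq_swap]
          exact hB j i h
  refine hc f fun e e' h => f.mapEdgeSet.injective (Subtype.ext (hS (hmem e) (hmem e') ?_))
  rw [hκ, hκ]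
  exact h

theorem numColors_le {c : SimpleGraph.TopEdgeLabeling (Fin 8) ℕ}
    (hc : ∀ f : twoPathFour.Copy (⊤ : SimpleGraph (Fin 8)), ¬ IsRainbowCopy c f) :
    numColors c ≤ 16 := by
  classical
  by_contra! hlt
  -- The value 0 on the diagonal is immaterial, as only subsets of `edgesEight` are colored.
  let κ : Sym2 (Fin 8) → ℕ := fun z =>
    if h : z ∈ (⊤ : SimpleGraph (Fin 8)).edgeSet then c ⟨z, h⟩ else 0
  have hκ : ∀ e, κ e.1 = c e := fun e => dif_pos e.2
  have himage : (edgesEight.image κ : Set ℕ) = Set.range c := by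
    ext k
    simp only [Finset.coe_image, Set.mem_image, Finset.mem_coe]
    constructor
    · rintro ⟨z, hz, rfl⟩
      exact ⟨⟨z, mem_edgeSet_top_iff.2 hz⟩, (hκ _).symm⟩
    · rintro ⟨e, rfl⟩
      exact ⟨e.1, mem_edgeSet_top_iff.1 e.2, hκ e⟩
  rw [numColors, ← himage, Set.ncard_coe_finset] at hlt
  obtain ⟨T, hT, hTc⟩ := Finset.exists_subset_card_eq (show 17 ≤ (edgesEight.image κ).card from hlt)
  obtain ⟨R, hR, hinj, hRT⟩ := Finset.exists_subset_injOn_image_eq_of_surjOn edgesEight T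
    (f := κ) fun k hk => by
      rw [← Finset.coe_image]
      exact hT hk
  have hRc : R.card = 17 := by rw [← hTc, ← hRT, Finset.card_image_of_injOn hinj]
  obtain ⟨R', hR', hRc', hinj', hiso⟩ := exists_injOn_forall_mem hR hRc hinj
  refine not_twoPathFree hR' hRc' hiso (fun z _ hz => ?_)
    (twoPathFree_of_not_isRainbowCopy hc hκ hinj')
  obtain ⟨f, hf, hf'⟩ := exists_injOn_insert_erase hinj' (Finset.card_pos.1 (by omega)) hz
  exact ⟨f, hf, twoPathFree_of_not_isRainbowCopy hc hκ hf'⟩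

/-! ### The extremal coloring -/

/-- The coloring in which the edges of a complete graph on six vertices have distinct colors and
all other edges have one further color. -/
def sixCliqueColoring : SimpleGraph.TopEdgeLabeling (Fin 8) ℕ := fun e => min (edgeCode e.1) 15

theorem numColors_sixCliqueColoring : numColors sixCliqueColoring = 16 := by
  have : Set.range sixCliqueColoring = (Finset.range 16 : Set ℕ) := by
    ext k
    simp only [Finset.coe_range, Set.mem_Iio]
    constructor
    · rintro ⟨e, rfl⟩
      exact Nat.lt_succ_of_le (min_le_right _ _)
    · intro hk
      have : ∀ k < 16, ∃ z ∈ edgesEight, min (edgeCode z) 15 = k := by decide +kernel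
      obtain ⟨z, hz, h⟩ := this k hk
      exact ⟨⟨z, mem_edgeSet_top_iff.2 hz⟩, h⟩
  rw [numColors, this, Set.ncard_coe_finset, Finset.card_range]

/-- No component of $2P_4$ is a single edge, so even adjacent vertices have distinct incident edges.
-/
theorem exists_adj_ne_of_ne {u v : Fin 4 ⊕ Fin 4} (h : u ≠ v) :
    ∃ x y, twoPathFour.Adj u x ∧ twoPathFour.Adj v y ∧ s(u, x) ≠ s(v, y) := by
  have key : ∀ i j : Fin 4, i ≠ j → ∃ x y : Fin 4, (i.val + 1 = x.val ∨ x.val + 1 = i.val) ∧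
      (j.val + 1 = y.val ∨ y.val + 1 = j.val) ∧ s(i, x) ≠ s(j, y) := by decide
  have hnbr : ∀ i : Fin 4, ∃ x : Fin 4, i.val + 1 = x.val ∨ x.val + 1 = i.val := by decide
  rcases u with i | i <;> rcases v with j | j
  · obtain ⟨x, y, hx, hy, hne⟩ := key i j (by simpa using h)
    exact ⟨.inl x, .inl y, SimpleGraph.pathGraph_adj.2 hx, SimpleGraph.pathGraph_adj.2 hy,
      by simpa using hne⟩
  · obtain ⟨x, hx⟩ := hnbr i
    obtain ⟨y, hy⟩ := hnbr j
    exact ⟨.inl x, .inr y, SimpleGraph.pathGraph_adj.2 hx, SimpleGraph.pathGraph_adj.2 hy,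
      by simp⟩
  · obtain ⟨x, hx⟩ := hnbr i
    obtain ⟨y, hy⟩ := hnbr j
    exact ⟨.inr x, .inl y, SimpleGraph.pathGraph_adj.2 hx, SimpleGraph.pathGraph_adj.2 hy,
      by simp⟩
  · obtain ⟨x, y, hx, hy, hne⟩ := key i j (by simpa using h)
    exact ⟨.inr x, .inr y, SimpleGraph.pathGraph_adj.2 hx, SimpleGraph.pathGraph_adj.2 hy,
      by simpa using hne⟩

theorem not_isRainbowCopy_sixCliqueColoring
    (f : twoPathFour.Copy (⊤ : SimpleGraph (Fin 8))) : ¬ IsRainbowCopy sixCliqueColoring f := by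
  intro hf
  have hsurj : Function.Surjective f :=
    ((Fintype.bijective_iff_injective_and_card f).2 ⟨f.injective, by simp⟩).2
  obtain ⟨u, hu⟩ := hsurj 6
  obtain ⟨v, hv⟩ := hsurj 7
  obtain ⟨x, y, hx, hy, hne⟩ := exists_adj_ne_of_ne (u := u) (v := v) (by
    rintro rfl
    rw [hu] at hv
    exact absurd hv (by decide))
  -- The positions 0 to 14 are exactly those of the pairs among the vertices 0 to 5.
  have hcode : ∀ a b : Fin 8, a ≠ b → 6 ≤ a → min (edgeIndex a b) 15 = 15 := by decide +kernel
  have hcolor : ∀ w x (h : twoPathFour.Adj w x), 6 ≤ f w →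
      sixCliqueColoring (f.mapEdgeSet ⟨s(w, x), h⟩) = 15 := fun w x h hw =>
    hcode (f w) (f x) (fun h' => h.ne (f.injective h')) hw
  have := @hf ⟨s(u, x), hx⟩ ⟨s(v, y), hy⟩ ((hcolor u x hx (by rw [hu])).trans
    (hcolor v y hy (by rw [hv]; decide)).symm)
  exact hne (congrArg Subtype.val this)

theorem lemma1 : IsAntiRamseyNumber 8 twoPathFour 16 := by
  refine ⟨⟨sixCliqueColoring, numColors_sixCliqueColoring, not_isRainbowCopy_sixCliqueColoring⟩,
    ?_⟩
  rintro k ⟨c, rfl, hc⟩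
  exact numColors_le hc
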